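/- There is an absolute constant $c>0$ such that the following holds. Let $n\ge 3$, $s\ge 1$, $m\ge 1$ be integers and let $F(x,y)\in\mathbb{Z}[x,y]$ be a binary form of degree $n$ that is irreducible over $\mathbb{Q}$ and lies in $C(4s-2)$, i.e. for all reals $(u,v)\neq(0,0)$ the form $uF_x+vF_y$ has at most $4s-2$ distinct real zeros in $\mathbb{P}^1(\mathbb{R})$. Write $F(x,y)=a_n\prod_{i=1}^n(x-\gamma_i y)$ with $\gamma_i\in\mathbb{C}$, let $D(F)=a_n^{2(n-1)}\prod_{i<j}(\gamma_i-\gamma_j)^2$ be its discriminant and $M=M(F)=|a_n|\prod_{i}\max(1,|\gamma_i|)$ its Mahler measure. Assume that $F$ has minimal Mahler measure, i.e. $M(F)\le M(G)$ for every form $G(x,y)=\pm F(ax+by,cx+dy)$ with $\begin{pmatrix}a&b\\c&d\end{pmatrix}\in \mathrm{GL}_2(\mathbb{Z})$, that $$|D(F)|>(n(n-1))^{8n(n-1)},$$ and that $$m\le \frac{|D(F)|^{\frac1{2(n-1)}}}{e^{200n}}.$$ Then the number of pairs $(x,y)\in\mathbb{Z}^2$ with $\gcd(x,y)=1$ (primitive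 solutions) that satisfy $$2^{-n}m\le F(x,y)<m\qquad\text{and}\qquad 0\le y\le (M/m)^5$$ is at most $c\,n$. -/

import Mathlib

/-- The ring `ℤ[x, y]`, with `x = X 0` and `y = X 1`, in which integral binary forms live
(homogeneity is imposed separately). -/
abbrev BinForm : Type := MvPolynomial (Fin 2) ℤ

namespace BinForm

noncomputable section

/-- The polynomial `F(z, 1)`, with complex coefficients. For `F = a_n x^n + ⋯ + a_0 y^n` with
`a_n ≠ 0` it is `a_n (z - γ_1) ⋯ (z - γ_n)`. -/
def dehom (F : BinForm) : Polynomial ℂ :=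
  MvPolynomial.aeval ![(Polynomial.X : Polynomial ℂ), 1] F

/-- The discriminant `a_n ^ (2 (n - 1)) ∏_{i < j} (γ_i - γ_j) ^ 2`, where `a_n` is the leading
coefficient, `n` the degree and `γ_1, …, γ_n` are the complex roots, listed with multiplicity,
of `F(z, 1)`. (The differences are squared, so the order of the list is irrelevant. The form `F`
is meant to have `a_n ≠ 0`, as every irreducible form of degree at least `2` does.) -/
def discr (F : BinForm) : ℂ :=
  F.dehom.leadingCoeff ^ (2 * (F.dehom.natDegree - 1)) *
    ∏ i : Fin F.dehom.roots.toList.length, ∏ j ∈ Finset.Ioi i,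
      (F.dehom.roots.toList.get i - F.dehom.roots.toList.get j) ^ 2

/-- The Mahler measure `|a_n| ∏ max (1, |γ_i|)`
(see `Polynomial.mahlerMeasure_eq_leadingCoeff_mul_prod_roots`). -/
def mahler (F : BinForm) : ℝ := F.dehom.mahlerMeasure

/-- The form `F_A(x, y) = F(ax + by, cx + dy)` for `A = (a, b; c, d)`. -/
def subst (A : Matrix (Fin 2) (Fin 2) ℤ) (F : BinForm) : BinForm :=
  MvPolynomial.bind₁ (fun i : Fin 2 =>
    MvPolynomial.C (A i 0) * MvPolynomial.X 0 + MvPolynomial.C (A i 1) * MvPolynomial.X 1) F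

/-- `F` and `G` are equivalent: `G = ± F_A` for some `A ∈ GL₂(ℤ)`. -/
def Equivalent (F G : BinForm) : Prop :=
  ∃ A : Matrix.GeneralLinearGroup (Fin 2) ℤ,
    G = subst (A : Matrix (Fin 2) (Fin 2) ℤ) F ∨ G = -subst (A : Matrix (Fin 2) (Fin 2) ℤ) F

/-- `F` has the smallest Mahler measure among all forms equivalent to it. -/
def HasMinimalMahler (F : BinForm) : Prop :=
  ∀ G : BinForm, F.Equivalent G → F.mahler ≤ G.mahler

/-- The real form `u F_x + v F_y`. -/
def dirDeriv (F : BinForm) (u v : ℝ) : MvPolynomial (Fin 2) ℝ :=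
  MvPolynomial.C u * MvPolynomial.map (Int.castRingHom ℝ) (MvPolynomial.pderiv 0 F) +
    MvPolynomial.C v * MvPolynomial.map (Int.castRingHom ℝ) (MvPolynomial.pderiv 1 F)

/-- The real zeros of a real binary form `G`, as points of the real projective line. -/
def realZeros (G : MvPolynomial (Fin 2) ℝ) : Set (Projectivization ℝ (Fin 2 → ℝ)) :=
  {P | MvPolynomial.eval P.rep G = 0}

/-- The class `C(t)` (for the degree `n`): forms of degree `n` with integer coefficients,
irreducible over `ℚ`, such that for all reals `(u, v) ≠ (0, 0)` the form `u F_x + v F_y` has at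
most `t` real zeros. -/
def classC (n t : ℕ) : Set BinForm :=
  {F | F.IsHomogeneous n ∧ Irreducible (MvPolynomial.map (Int.castRingHom ℚ) F) ∧
    ∀ u v : ℝ, (u, v) ≠ (0, 0) → (realZeros (F.dirDeriv u v)).encard ≤ t}

/-- The value `F(x, y)` at an integer point. -/
def value (F : BinForm) (x y : ℤ) : ℤ := MvPolynomial.eval ![x, y] F

/-- The primitive integer solutions `(x, y)` of `2⁻ⁿ m ≤ F(x, y) < m` that are small, that is,
`0 ≤ y ≤ (M / m) ^ 5`, where `M` is the Mahler measure of `F`. -/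
def smallSolutions (n m : ℕ) (F : BinForm) : Set (ℤ × ℤ) :=
  {p | Int.gcd p.1 p.2 = 1 ∧
    (m : ℝ) / 2 ^ n ≤ (F.value p.1 p.2 : ℝ) ∧ (F.value p.1 p.2 : ℝ) < m ∧
    0 ≤ p.2 ∧ (p.2 : ℝ) ≤ (F.mahler / m) ^ 5}

end

end BinForm

/-!
The closeness of an integer point `(x, y)`, `y > 0`, to a root `γ` of `F(z, 1)` is
`max(1, 1 / (2 y |x - γ y|))`, and the point is close to `γ` when this exceeds `1`. Two distinct
primitive points with `y > 0` have a determinant that is at least `1` in absolute value,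
so if `p` and a later point `q` are both close to `γ`, the closeness of `p` is at most
`q.2 / p.2`. These bounds telescope: for each root, the product of the closeness over all points,
omitting the last close one, is at most the largest `y`, hence at most `(M / m) ^ 5`.

In the other direction, complete a primitive solution `p` to a unimodular matrix with second column
`q`. Minimality of `M` gives `M ≤ |F(p)| ∏ max(1, |L_i(q) / L_i(p)|)` with `L_i = x - γ_i y`, and
reducing `q` modulo `p` bounds each factor by three times the closeness of `p` to `γ_i`. So every
solution has a product of closeness over the roots of at least `(M / m) / 3 ^ n`. The trivial bound
`|D| ≤ (2 ^ n M) ^ (2 (n - 1))` turns the assumption on `m` into `M / m ≥ 9 ^ n`, so that this is at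
least `(M / m) ^ (1 / 2)`. Multiplying over all solutions except the `n` omitted ones leaves at most
`10 n` of them.
-/

section GapCounting

theorem prod_le_of_gap {α : Type*} {y v : α → ℝ} (T : Finset α) {b : ℝ} (hb : 1 ≤ b)
    (hy : ∀ p ∈ T, 1 ≤ y p) (hv : ∀ p ∈ T, 0 ≤ v p)
    (hgap : ∀ p ∈ T, ∀ q ∈ T, p ≠ q → y p ≤ y q → v p ≤ y q / y p)
    (hvb : ∀ p ∈ T, v p ≤ b / y p) : ∏ p ∈ T, v p ≤ b := by
  classical
  induction T using Finset.induction_on_max_value y generalizing b with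
  | empty => simpa using hb
  | insert e s he hmax ih =>
    simp only [Finset.forall_mem_insert] at hy hv hgap hvb
    -- All other points lie below `e`, so the gap condition at `e` lets `y e` play the role of `b`.
    have hprod : ∏ p ∈ s, v p ≤ y e :=
      ih hy.1 hy.2 hv.2 (fun p hp => (hgap.2 p hp).2)
        fun p hp => (hgap.2 p hp).1 (ne_of_mem_of_not_mem hp he) (hmax p hp)
    have hye : 0 < y e := one_pos.trans_le hy.1
    calc ∏ p ∈ insert e s, v p = v e * ∏ p ∈ s, v p := Finset.prod_insert he
      _ ≤ b / y e * y e :=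
          mul_le_mul hvb.1 hprod (Finset.prod_nonneg hv.2) (by positivity)
      _ = b := div_mul_cancel₀ b hye.ne'

theorem exists_card_le_one_prod_sdiff_le {α : Type*} [DecidableEq α] {y v : α → ℝ} (S : Finset α)
    {b : ℝ} (hb : 1 ≤ b) (hy : ∀ p ∈ S, 1 ≤ y p) (hyb : ∀ p ∈ S, y p ≤ b)
    (hv : ∀ p ∈ S, 1 ≤ v p)
    (hgap : ∀ p ∈ S, ∀ q ∈ S, p ≠ q → y p ≤ y q → 1 < v q → v p ≤ y q / y p) :
    ∃ E : Finset α, E.card ≤ 1 ∧ ∏ p ∈ S \ E, v p ≤ b := by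
  have hfilter (E : Finset α) : ∏ p ∈ S \ E with 1 < v p, v p = ∏ p ∈ S \ E, v p :=
    Finset.prod_filter_of_ne fun p hp hne =>
      (hv p (Finset.mem_sdiff.mp hp).1).lt_of_ne' hne
  rcases (S.filter (1 < v ·)).eq_empty_or_nonempty with hT | hT
  · refine ⟨∅, by simp, ?_⟩
    rw [← hfilter, Finset.sdiff_empty, hT, Finset.prod_empty]
    exact hb
  · obtain ⟨e, he, hmax⟩ := Finset.exists_max_image _ y hT
    simp only [Finset.mem_filter] at he hmax
    refine ⟨{e}, by simp, ?_⟩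
    rw [← hfilter]
    refine (prod_le_of_gap (y := y) _ (hy e he.1) ?_ ?_ ?_ ?_).trans (hyb e he.1) <;>
      simp only [Finset.mem_filter, Finset.mem_sdiff, Finset.mem_singleton]
    · exact fun p hp => hy p hp.1.1
    · exact fun p hp => zero_le_one.trans (hv p hp.1.1)
    · exact fun p hp q hq hne hle => hgap p hp.1.1 q hq.1.1 hne hle hq.2
    · exact fun p hp => hgap p hp.1.1 e he.1 hp.1.2 (hmax p ⟨hp.1.1, hp.2⟩) he.2

variable {ι α : Type*} [Fintype ι] {y : α → ℝ} {v : ι → α → ℝ} {Q : ℝ} {k : ℕ}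

theorem card_le_of_gap {S : Finset α} (hQ : 1 < Q)
    (hy : ∀ p ∈ S, 1 ≤ y p) (hyQ : ∀ p ∈ S, y p ≤ Q ^ k) (hv : ∀ i, ∀ p ∈ S, 1 ≤ v i p)
    (hgap : ∀ i, ∀ p ∈ S, ∀ q ∈ S, p ≠ q → y p ≤ y q → 1 < v i q → v i p ≤ y q / y p)
    (hQv : ∀ p ∈ S, Q ≤ ∏ i, v i p) :
    S.card ≤ (k + 1) * Fintype.card ι := by
  classical
  choose E hEcard hE using fun i =>
    exists_card_le_one_prod_sdiff_le S (one_le_pow₀ hQ.le) hy hyQ (hv i) (hgap i)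
  set B := Finset.univ.biUnion E
  have hB : B.card ≤ Fintype.card ι := by
    simpa using Finset.card_biUnion_le_card_mul Finset.univ E 1 fun i _ => hEcard i
  have hprod (i : ι) : ∏ p ∈ S \ B, v i p ≤ Q ^ k :=
    have hsub : S \ B ⊆ S \ E i :=
      Finset.sdiff_subset_sdiff le_rfl (Finset.subset_biUnion_of_mem E (Finset.mem_univ i))
    (Finset.prod_le_prod_of_subset_of_one_le hsub
      (fun p hp => zero_le_one.trans (hv i p (Finset.mem_sdiff.mp hp).1))
      fun p hp _ => hv i p (Finset.mem_sdiff.mp hp).1).trans (hE i)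
  have hpow : Q ^ (S \ B).card ≤ Q ^ (k * Fintype.card ι) :=
    calc Q ^ (S \ B).card = ∏ _p ∈ S \ B, Q := (Finset.prod_const Q).symm
      _ ≤ ∏ p ∈ S \ B, ∏ i, v i p :=
          Finset.prod_le_prod (fun _ _ => zero_le_one.trans hQ.le)
            fun p hp => hQv p (Finset.mem_sdiff.mp hp).1
      _ = ∏ i, ∏ p ∈ S \ B, v i p := Finset.prod_comm
      _ ≤ ∏ _i : ι, Q ^ k :=
          Finset.prod_le_prod (fun i _ => Finset.prod_nonneg fun p hp =>
            zero_le_one.trans (hv i p (Finset.mem_sdiff.mp hp).1)) fun i _ => hprod i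
      _ = Q ^ (k * Fintype.card ι) := by rw [Finset.prod_const, Finset.card_univ, pow_mul]
  have hcard : (S \ B).card ≤ k * Fintype.card ι := (pow_le_pow_iff_right₀ hQ).mp hpow
  calc S.card ≤ (S \ B).card + B.card := Finset.card_le_card_sdiff_add_card
    _ ≤ k * Fintype.card ι + Fintype.card ι := add_le_add hcard hB
    _ = (k + 1) * Fintype.card ι := by ring

theorem encard_le_of_gap {S : Set α} (hQ : 1 < Q)
    (hy : ∀ p ∈ S, 1 ≤ y p) (hyQ : ∀ p ∈ S, y p ≤ Q ^ k) (hv : ∀ i, ∀ p ∈ S, 1 ≤ v i p)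
    (hgap : ∀ i, ∀ p ∈ S, ∀ q ∈ S, p ≠ q → y p ≤ y q → 1 < v i q → v i p ≤ y q / y p)
    (hQv : ∀ p ∈ S, Q ≤ ∏ i, v i p) :
    S.encard ≤ ((k + 1) * Fintype.card ι : ℕ) := by
  by_contra! hlt
  obtain ⟨T, hTS, hTcard⟩ := Set.exists_subset_encard_eq (Order.add_one_le_of_lt hlt)
  lift T to Finset α using Set.finite_of_encard_eq_coe hTcard
  have hT := card_le_of_gap (S := T) hQ (fun p hp => hy p (hTS hp)) (fun p hp => hyQ p (hTS hp))
    (fun i p hp => hv i p (hTS hp)) (fun i p hp q hq => hgap i p (hTS hp) q (hTS hq))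
    fun p hp => hQv p (hTS hp)
  rw [Set.encard_coe_eq_coe_finsetCard] at hTcard
  have : T.card = (k + 1) * Fintype.card ι + 1 := by exact_mod_cast hTcard
  omega

end GapCounting

section PrimitivePoints

theorem det_ne_zero_of_primitive {p q : ℤ × ℤ} (hp : 0 < p.2) (hq : 0 < q.2)
    (hp1 : Int.gcd p.1 p.2 = 1) (hq1 : Int.gcd q.1 q.2 = 1) (hne : p ≠ q) :
    p.1 * q.2 - q.1 * p.2 ≠ 0 := by
  intro hdet
  have hpQ : (p.2 : ℚ) ≠ 0 := by exact_mod_cast hp.ne'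
  have hqQ : (q.2 : ℚ) ≠ 0 := by exact_mod_cast hq.ne'
  have hfrac : (p.1 : ℚ) / p.2 = q.1 / q.2 := by
    rw [div_eq_div_iff hpQ hqQ]
    exact_mod_cast sub_eq_zero.mp hdet
  exact hne (Prod.ext_iff.mpr (Rat.div_int_inj hp hq hp1 hq1 hfrac))

theorem exists_det_eq_one {p : ℤ × ℤ} (hp : 0 < p.2) (hp1 : Int.gcd p.1 p.2 = 1) :
    ∃ q : ℤ × ℤ, p.1 * q.2 - q.1 * p.2 = 1 ∧ 0 ≤ q.2 ∧ q.2 < p.2 := by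
  obtain ⟨u, v, huv⟩ := Int.isCoprime_iff_gcd_eq_one.mpr hp1
  refine ⟨(-(v + p.1 * (u / p.2)), u % p.2), ?_, Int.emod_nonneg _ hp.ne', Int.emod_lt_of_pos _ hp⟩
  linear_combination huv + p.1 * Int.emod_add_mul_ediv u p.2

theorem encard_primitive_snd_eq_zero_le :
    {p : ℤ × ℤ | Int.gcd p.1 p.2 = 1 ∧ p.2 = 0}.encard ≤ 2 := by
  have hsub : {p : ℤ × ℤ | Int.gcd p.1 p.2 = 1 ∧ p.2 = 0} ⊆ {(1, 0), (-1, 0)} := by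
    rintro ⟨x, y⟩ ⟨hgcd, rfl : y = 0⟩
    rw [Int.gcd_zero_right, Int.natAbs_eq_iff] at hgcd
    simpa using hgcd
  exact (Set.encard_le_encard hsub).trans (Set.encard_pair (by decide)).le

end PrimitivePoints

section Closeness

/-- The linear form `x - γ y` at the integer point `(x, y)`. -/
noncomputable def linForm (γ : ℂ) (p : ℤ × ℤ) : ℂ := p.1 - γ * p.2

/-- How well `x / y` approximates `γ`, for an integer point `p = (x, y)` with `y > 0`:
the larger of `1` and `1 / (2 y |x - γ y|)`. If `x = γ y` the division by zero makes it `1`. -/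
noncomputable def closeness (γ : ℂ) (p : ℤ × ℤ) : ℝ := max 1 (1 / (2 * p.2 * ‖linForm γ p‖))

theorem one_le_closeness (γ : ℂ) (p : ℤ × ℤ) : 1 ≤ closeness γ p := le_max_left _ _

variable {γ : ℂ} {p q : ℤ × ℤ}

theorem one_le_norm_linForm_mul_add (hp : 0 < p.2) (hq : 0 < q.2)
    (hp1 : Int.gcd p.1 p.2 = 1) (hq1 : Int.gcd q.1 q.2 = 1) (hne : p ≠ q) :
    1 ≤ ‖linForm γ p‖ * q.2 + ‖linForm γ q‖ * p.2 := by
  have hpR : (0 : ℝ) < p.2 := by exact_mod_cast hp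
  have hqR : (0 : ℝ) < q.2 := by exact_mod_cast hq
  calc (1 : ℝ) ≤ ‖((p.1 * q.2 - q.1 * p.2 : ℤ) : ℂ)‖ := by
        rw [Complex.norm_intCast]
        exact_mod_cast Int.one_le_abs (det_ne_zero_of_primitive hp hq hp1 hq1 hne)
    _ = ‖linForm γ p * q.2 - linForm γ q * p.2‖ := by
        simp only [linForm]
        push_cast
        ring_nf
    _ ≤ ‖linForm γ p * q.2‖ + ‖linForm γ q * p.2‖ := norm_sub_le _ _
    _ = ‖linForm γ p‖ * q.2 + ‖linForm γ q‖ * p.2 := by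
        rw [norm_mul, norm_mul, Complex.norm_intCast, Complex.norm_intCast, abs_of_pos hpR,
          abs_of_pos hqR]

theorem closeness_le_div (hp : 0 < p.2) (hpq : p.2 ≤ q.2) (hp1 : Int.gcd p.1 p.2 = 1)
    (hq1 : Int.gcd q.1 q.2 = 1) (hne : p ≠ q) (hclose : 1 < closeness γ q) :
    closeness γ p ≤ q.2 / p.2 := by
  have hpR : (0 : ℝ) < p.2 := by exact_mod_cast hp
  have hpqR : (p.2 : ℝ) ≤ q.2 := by exact_mod_cast hpq
  have hLq : 2 * q.2 * ‖linForm γ q‖ < 1 := by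
    have h : 1 < 1 / (2 * q.2 * ‖linForm γ q‖) :=
      (lt_max_iff.mp hclose).resolve_left (lt_irrefl _)
    have hpos : 0 < 2 * q.2 * ‖linForm γ q‖ := one_div_pos.mp (one_pos.trans h)
    rwa [one_lt_div hpos] at h
  have hLqp : ‖linForm γ q‖ * p.2 ≤ ‖linForm γ q‖ * q.2 := by gcongr
  have hLp : 1 ≤ 2 * (‖linForm γ p‖ * q.2) := by
    linarith [one_le_norm_linForm_mul_add (γ := γ) hp (hp.trans_le hpq) hp1 hq1 hne]
  have hLpos : 0 < ‖linForm γ p‖ :=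
    pos_of_mul_pos_left (by linarith) (hpR.le.trans hpqR)
  refine max_le ((one_le_div hpR).mpr hpqR) ?_
  rw [div_le_div_iff₀ (by positivity) hpR]
  linarith [mul_le_mul_of_nonneg_right hLp hpR.le]

theorem max_norm_linForm_le (hp : 0 < p.2) (hdet : p.1 * q.2 - q.1 * p.2 = 1)
    (hq : |q.2| ≤ p.2) (hLp : linForm γ p ≠ 0) :
    max ‖linForm γ p‖ ‖linForm γ q‖ ≤ 3 * closeness γ p * ‖linForm γ p‖ := by
  have hpR : (0 : ℝ) < p.2 := by exact_mod_cast hp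
  have hqR : |(q.2 : ℝ)| ≤ p.2 := by exact_mod_cast hq
  have hLpos : 0 < ‖linForm γ p‖ := norm_pos_iff.mpr hLp
  have hLq : p.2 * ‖linForm γ q‖ ≤ p.2 * ‖linForm γ p‖ + 1 := by
    have hid : p.2 * linForm γ q = q.2 * linForm γ p - 1 := by
      have hdetC : (p.1 : ℂ) * q.2 - q.1 * p.2 = 1 := by exact_mod_cast hdet
      simp only [linForm]
      linear_combination -hdetC
    calc p.2 * ‖linForm γ q‖ = ‖p.2 * linForm γ q‖ := by
          rw [norm_mul, Complex.norm_intCast, abs_of_pos hpR]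
      _ ≤ ‖q.2 * linForm γ p‖ + ‖(1 : ℂ)‖ := hid ▸ norm_sub_le _ _
      _ ≤ p.2 * ‖linForm γ p‖ + 1 := by
          rw [norm_mul, Complex.norm_intCast, norm_one]
          gcongr
  have hc1 := one_le_closeness γ p
  have hc2 : 1 ≤ 2 * p.2 * ‖linForm γ p‖ * closeness γ p := by
    rw [← div_le_iff₀' (by positivity)]
    exact le_max_right _ _
  have hc3 : ‖linForm γ p‖ ≤ closeness γ p * ‖linForm γ p‖ :=
    le_mul_of_one_le_left hLpos.le hc1
  refine max_le (by linarith) (le_of_mul_le_mul_left ?_ hpR)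
  linarith [mul_le_mul_of_nonneg_left hc3 hpR.le]

end Closeness

section Differences

theorem prod_prod_Ioi_mul_eq_pow {ι M : Type*} [Fintype ι] [LinearOrder ι]
    [LocallyFiniteOrderTop ι] [LocallyFiniteOrderBot ι] [CommMonoid M] (b : ι → M) :
    ∏ i, ∏ j ∈ Finset.Ioi i, b i * b j = (∏ i, b i) ^ (Fintype.card ι - 1) := by
  rw [Finset.prod_prod_Ioi_mul_eq_prod_prod_off_diag fun _ i => b i]
  simp [Finset.prod_const, Finset.card_compl, Finset.prod_pow]

theorem norm_sub_le_two_max_mul {E : Type*} [SeminormedAddCommGroup E] (a b : E) :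
    ‖a - b‖ ≤ (2 * max 1 ‖a‖) * (2 * max 1 ‖b‖) := by
  have ha := le_max_left 1 ‖a‖
  have ha' := le_max_right 1 ‖a‖
  have hb := le_max_left 1 ‖b‖
  have hb' := le_max_right 1 ‖b‖
  nlinarith [norm_sub_le a b]

end Differences

namespace BinForm

section Homogeneous

variable {R : Type*} [CommSemiring R] {n : ℕ} {F : MvPolynomial (Fin 2) R}

theorem eq_add_of_mem_support (hF : F.IsHomogeneous n) {d : Fin 2 →₀ ℕ}
    (hd : d ∈ F.support) : n = d 0 + d 1 := by
  rw [hF.degree_eq_sum_deg_support hd, ← Finsupp.degree_apply, Finsupp.degree_eq_sum,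
    Fin.sum_univ_two]

theorem X_one_dvd_of_coeff_eq_zero (hF : F.IsHomogeneous n)
    (h : F.coeff (Finsupp.single 0 n) = 0) : MvPolynomial.X 1 ∣ F := by
  rw [F.as_sum]
  refine Finset.dvd_sum fun d hd => MvPolynomial.X_dvd_monomial.mpr (Or.inr fun hd1 => ?_)
  have hd0 : d = Finsupp.single 0 n := by
    have hdeg := eq_add_of_mem_support hF hd
    ext i
    fin_cases i <;> simp [hdeg, hd1]
  exact MvPolynomial.mem_support_iff.mp hd (hd0 ▸ h)

theorem coeff_ne_zero_of_irreducible {R : Type*} [CommRing R] [IsDomain R]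
    {F : MvPolynomial (Fin 2) R} (hn : 2 ≤ n)
    (hF : F.IsHomogeneous n) (hirr : Irreducible F) : F.coeff (Finsupp.single 0 n) ≠ 0 := by
  intro h
  have hX : Irreducible (MvPolynomial.X 1 : MvPolynomial (Fin 2) R) :=
    MvPolynomial.X_prime.irreducible
  have hdvd : F ∣ MvPolynomial.X 1 := hX.dvd_symm hirr (X_one_dvd_of_coeff_eq_zero hF h)
  have hdeg := MvPolynomial.totalDegree_le_of_dvd_of_isDomain hdvd hX.ne_zero
  rw [hF.totalDegree hirr.ne_zero, MvPolynomial.totalDegree_X] at hdeg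
  omega

theorem aeval_mul_left {S : Type*} [CommSemiring S] [Algebra R S]
    (hF : F.IsHomogeneous n) (v x y : S) :
    MvPolynomial.aeval ![v * x, v * y] F = v ^ n * MvPolynomial.aeval ![x, y] F := by
  simp only [MvPolynomial.aeval_def, MvPolynomial.eval₂_eq', Finset.mul_sum, Fin.prod_univ_two,
    Matrix.cons_val_zero, Matrix.cons_val_one]
  refine Finset.sum_congr rfl fun d hd => ?_
  rw [eq_add_of_mem_support hF hd]
  ring

end Homogeneous

section Factorization

theorem eval_dehom (F : BinForm) (z : ℂ) : F.dehom.eval z = MvPolynomial.aeval ![z, 1] F := by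
  simp [dehom, MvPolynomial.aeval_def, MvPolynomial.eval₂_eq', Polynomial.eval_finsetSum,
    Fin.prod_univ_two]

theorem eval_dehom_subst (A : Matrix (Fin 2) (Fin 2) ℤ) (F : BinForm) (z : ℂ) :
    (subst A F).dehom.eval z =
      MvPolynomial.aeval ![(A 0 0 : ℂ) * z + A 0 1, (A 1 0 : ℂ) * z + A 1 1] F := by
  rw [eval_dehom, subst, MvPolynomial.aeval_bind₁]
  simp only [map_add, map_mul, MvPolynomial.aeval_C, MvPolynomial.aeval_X]
  simp [MvPolynomial.aeval_def, MvPolynomial.eval₂_eq', Fin.prod_univ_two]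

theorem intCast_value (F : BinForm) (x y : ℤ) :
    (F.value x y : ℂ) = MvPolynomial.aeval ![(x : ℂ), (y : ℂ)] F := by
  simp [value, MvPolynomial.aeval_def, MvPolynomial.eval_eq', MvPolynomial.eval₂_eq',
    Fin.prod_univ_two]

theorem natDegree_dehom {n : ℕ} {F : BinForm} (hF : F.IsHomogeneous n)
    (hlead : F.coeff (Finsupp.single 0 n) ≠ 0) : F.dehom.natDegree = n := by
  have hsum : F.dehom = ∑ d ∈ F.support,
      Polynomial.C ((MvPolynomial.coeff d F : ℤ) : ℂ) * Polynomial.X ^ d 0 := by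
    rw [dehom, MvPolynomial.aeval_def, MvPolynomial.eval₂_eq']
    simp [Fin.prod_univ_two]
  have hdeg : ∀ d ∈ F.support, n = d 0 + d 1 := fun d hd => eq_add_of_mem_support hF hd
  refine Polynomial.natDegree_eq_of_le_of_coeff_ne_zero ?_ ?_
  · rw [hsum]
    refine Polynomial.natDegree_sum_le_of_forall_le _ _ fun d hd => ?_
    exact (Polynomial.natDegree_C_mul_X_pow_le _ _).trans (by grind)
  · rw [hsum, Polynomial.finsetSum_coeff, Finset.sum_eq_single (Finsupp.single 0 n)]
    · simpa using hlead
    · intro d hd hne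
      rw [Polynomial.coeff_C_mul_X_pow, if_neg]
      intro h
      apply hne
      have := hdeg d hd
      ext i
      fin_cases i <;> simp <;> omega
    · exact fun h => absurd (MvPolynomial.mem_support_iff.mpr hlead) h

/-- The roots `γ_i` of `F(z, 1)`, listed with multiplicity in the order used by `discr`. -/
noncomputable def root (F : BinForm) (i : Fin F.dehom.roots.toList.length) : ℂ :=
  F.dehom.roots.toList.get i

theorem card_root_index (F : BinForm) :
    Fintype.card (Fin F.dehom.roots.toList.length) = F.dehom.natDegree := by
  rw [Fintype.card_fin, Multiset.length_toList]
  exact (IsAlgClosed.splits F.dehom).natDegree_eq_card_roots.symm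

theorem prod_map_roots {M : Type*} [CommMonoid M] (F : BinForm) (f : ℂ → M) :
    (F.dehom.roots.map f).prod = ∏ i, f (F.root i) := by
  rw [← Multiset.prod_map_toList, ← Fin.prod_univ_fun_getElem]
  rfl

theorem mahler_eq (F : BinForm) :
    F.mahler = ‖F.dehom.leadingCoeff‖ * ∏ i, max 1 ‖F.root i‖ := by
  rw [mahler, Polynomial.mahlerMeasure_eq_leadingCoeff_mul_prod_roots, prod_map_roots]

variable {F : BinForm}

theorem aeval_eq_prod (hF : F.IsHomogeneous F.dehom.natDegree) (u v : ℂ) :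
    MvPolynomial.aeval ![u, v] F = F.dehom.leadingCoeff * ∏ i, (u - F.root i * v) := by
  have hcont : Continuous fun v : ℂ => MvPolynomial.aeval ![u, v] F := by
    simp only [MvPolynomial.aeval_def, MvPolynomial.eval₂_eq', Fin.prod_univ_two,
      Matrix.cons_val_zero, Matrix.cons_val_one]
    fun_prop
  have hcont' : Continuous fun v : ℂ => F.dehom.leadingCoeff * ∏ i, (u - F.root i * v) := by
    fun_prop
  refine congrFun (hcont.ext_on (dense_compl_singleton 0) hcont' fun v (hv : v ≠ 0) => ?_) v
  calc MvPolynomial.aeval ![u, v] F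
      = v ^ F.dehom.natDegree * F.dehom.eval (u / v) := by
        rw [eval_dehom, ← aeval_mul_left hF, mul_div_cancel₀ u hv, mul_one]
    _ = v ^ F.dehom.natDegree * (F.dehom.leadingCoeff * ∏ i, (u / v - F.root i)) := by
        rw [(IsAlgClosed.splits F.dehom).eval_eq_prod_roots, prod_map_roots]
    _ = F.dehom.leadingCoeff * ∏ i, v * (u / v - F.root i) := by
        rw [mul_left_comm, Finset.prod_mul_distrib, Finset.prod_const, Finset.card_univ,
          card_root_index]
    _ = F.dehom.leadingCoeff * ∏ i, (u - F.root i * v) := by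
        simp only [mul_sub, mul_div_cancel₀ u hv, mul_comm _ v]

theorem intCast_value_eq_prod (hF : F.IsHomogeneous F.dehom.natDegree) (p : ℤ × ℤ) :
    (F.value p.1 p.2 : ℂ) = F.dehom.leadingCoeff * ∏ i, linForm (F.root i) p := by
  rw [intCast_value, aeval_eq_prod hF]
  rfl

theorem abs_value_eq_prod (hF : F.IsHomogeneous F.dehom.natDegree) (p : ℤ × ℤ) :
    |(F.value p.1 p.2 : ℝ)| = ‖F.dehom.leadingCoeff‖ * ∏ i, ‖linForm (F.root i) p‖ := by
  rw [← Complex.norm_intCast, intCast_value_eq_prod hF, norm_mul, norm_prod]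

theorem dehom_subst_eq_prod (hF : F.IsHomogeneous F.dehom.natDegree) (p q : ℤ × ℤ) :
    (subst !![p.1, q.1; p.2, q.2] F).dehom = Polynomial.C F.dehom.leadingCoeff *
      ∏ i, (Polynomial.C (linForm (F.root i) p) * Polynomial.X +
        Polynomial.C (linForm (F.root i) q)) := by
  refine Polynomial.funext fun z => ?_
  rw [eval_dehom_subst, aeval_eq_prod hF, Polynomial.eval_mul, Polynomial.eval_C,
    Polynomial.eval_prod]
  congr! 2 with i
  simp [linForm]
  ring

end Factorization

section Mahler

variable {F : BinForm}

theorem mahler_subst (hF : F.IsHomogeneous F.dehom.natDegree) (p q : ℤ × ℤ) :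
    (subst !![p.1, q.1; p.2, q.2] F).mahler = ‖F.dehom.leadingCoeff‖ *
      ∏ i, max ‖linForm (F.root i) p‖ ‖linForm (F.root i) q‖ := by
  have hlin (a b : ℂ) :
      (Polynomial.C a * Polynomial.X + Polynomial.C b).mahlerMeasure = max ‖a‖ ‖b‖ := by
    rcases eq_or_ne a 0 with rfl | ha
    · simp
    · exact Polynomial.mahlerMeasure_C_mul_X_add_C ha b
  rw [mahler, dehom_subst_eq_prod hF, Polynomial.mahlerMeasure_mul, Polynomial.mahlerMeasure_const,
    Finset.prod_eq_multiset_prod, Polynomial.prod_mahlerMeasure_eq_mahlerMeasure_prod,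
    Multiset.map_map, ← Finset.prod_eq_multiset_prod]
  simp only [Function.comp_apply, hlin]

theorem mahler_le_prod_max (hF : F.IsHomogeneous F.dehom.natDegree) (hmin : F.HasMinimalMahler)
    {p q : ℤ × ℤ} (hdet : p.1 * q.2 - q.1 * p.2 = 1) :
    F.mahler ≤ ‖F.dehom.leadingCoeff‖ *
      ∏ i, max ‖linForm (F.root i) p‖ ‖linForm (F.root i) q‖ := by
  have hunit : IsUnit (!![p.1, q.1; p.2, q.2] : Matrix (Fin 2) (Fin 2) ℤ).det := by
    rw [Matrix.det_fin_two_of, hdet]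
    exact isUnit_one
  rw [← mahler_subst hF]
  exact hmin _ ⟨Matrix.GeneralLinearGroup.mk'' _ hunit, Or.inl rfl⟩

theorem mahler_le_abs_value_mul_prod_closeness (hF : F.IsHomogeneous F.dehom.natDegree)
    (hmin : F.HasMinimalMahler) {p : ℤ × ℤ} (hp : 0 < p.2) (hp1 : Int.gcd p.1 p.2 = 1)
    (hv : F.value p.1 p.2 ≠ 0) :
    F.mahler ≤
      |(F.value p.1 p.2 : ℝ)| * (3 ^ F.dehom.natDegree * ∏ i, closeness (F.root i) p) := by
  obtain ⟨q, hdet, hq0, hqp⟩ := exists_det_eq_one hp hp1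
  have hL (i) : linForm (F.root i) p ≠ 0 := by
    have hprod : F.dehom.leadingCoeff * ∏ i, linForm (F.root i) p ≠ 0 := by
      rw [← intCast_value_eq_prod hF]
      exact_mod_cast hv
    exact Finset.prod_ne_zero_iff.mp (right_ne_zero_of_mul hprod) i (Finset.mem_univ i)
  calc F.mahler
      ≤ ‖F.dehom.leadingCoeff‖ * ∏ i, max ‖linForm (F.root i) p‖ ‖linForm (F.root i) q‖ :=
        mahler_le_prod_max hF hmin hdet
    _ ≤ ‖F.dehom.leadingCoeff‖ *
          ∏ i, 3 * closeness (F.root i) p * ‖linForm (F.root i) p‖ := by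
        gcongr with i
        exact max_norm_linForm_le hp hdet (by rw [abs_of_nonneg hq0]; exact hqp.le) (hL i)
    _ = |(F.value p.1 p.2 : ℝ)| * (3 ^ F.dehom.natDegree * ∏ i, closeness (F.root i) p) := by
        rw [abs_value_eq_prod hF, Finset.prod_mul_distrib, Finset.prod_mul_distrib,
          Finset.prod_const, Finset.card_univ, card_root_index]
        ring

end Mahler

section Discriminant

theorem norm_discr_le (F : BinForm) :
    ‖F.discr‖ ≤ (2 ^ F.dehom.natDegree * F.mahler) ^ (2 * (F.dehom.natDegree - 1)) := by
  set b : Fin F.dehom.roots.toList.length → ℝ := fun i => 2 * max 1 ‖F.root i‖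
  have hprod : ∏ i, b i = 2 ^ F.dehom.natDegree * ∏ i, max 1 ‖F.root i‖ := by
    rw [Finset.prod_mul_distrib, Finset.prod_const, Finset.card_univ, card_root_index]
  calc ‖F.discr‖
      = ‖F.dehom.leadingCoeff‖ ^ (2 * (F.dehom.natDegree - 1)) *
          ∏ i, ∏ j ∈ Finset.Ioi i, ‖F.root i - F.root j‖ ^ 2 := by
        simp only [discr, norm_mul, norm_pow, norm_prod, root]
    _ ≤ ‖F.dehom.leadingCoeff‖ ^ (2 * (F.dehom.natDegree - 1)) *
          ∏ i, ∏ j ∈ Finset.Ioi i, (b i * b j) ^ 2 := by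
        gcongr
        exact norm_sub_le_two_max_mul _ _
    _ = (2 ^ F.dehom.natDegree * F.mahler) ^ (2 * (F.dehom.natDegree - 1)) := by
        simp only [Finset.prod_pow]
        rw [prod_prod_Ioi_mul_eq_pow, card_root_index, hprod, mahler_eq]
        ring

theorem norm_discr_rpow_le {n : ℕ} {F : BinForm} (hn : 2 ≤ n) (hdeg : F.dehom.natDegree = n) :
    ‖F.discr‖ ^ (1 / (2 * ((n : ℝ) - 1))) ≤ 2 ^ n * F.mahler := by
  have hexp : 1 / (2 * ((n : ℝ) - 1)) = ((2 * (n - 1) : ℕ) : ℝ)⁻¹ := by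
    rw [one_div, Nat.cast_mul, Nat.cast_two, Nat.cast_pred (by omega)]
  have hM : 0 ≤ F.mahler := Polynomial.mahlerMeasure_nonneg _
  rw [hexp]
  calc ‖F.discr‖ ^ ((2 * (n - 1) : ℕ) : ℝ)⁻¹
      ≤ ((2 ^ n * F.mahler) ^ (2 * (n - 1))) ^ ((2 * (n - 1) : ℕ) : ℝ)⁻¹ := by
        gcongr
        exact hdeg ▸ norm_discr_le F
    _ = 2 ^ n * F.mahler := Real.pow_rpow_inv_natCast (by positivity) (by omega)

theorem pow_mul_le_mahler {n : ℕ} {F : BinForm} {c m : ℝ} (hn : 2 ≤ n)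
    (hdeg : F.dehom.natDegree = n) (hc : 0 < c)
    (hm : m ≤ ‖F.discr‖ ^ (1 / (2 * ((n : ℝ) - 1))) / (2 * c) ^ n) : c ^ n * m ≤ F.mahler := by
  have h : 2 ^ n * (c ^ n * m) ≤ 2 ^ n * F.mahler :=
    calc 2 ^ n * (c ^ n * m) = m * (2 * c) ^ n := by ring
      _ ≤ ‖F.discr‖ ^ (1 / (2 * ((n : ℝ) - 1))) := (le_div_iff₀ (by positivity)).mp hm
      _ ≤ 2 ^ n * F.mahler := norm_discr_rpow_le hn hdeg
  exact le_of_mul_le_mul_left h (by positivity)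

end Discriminant

section Solutions

/-- The primitive integer points `(x, y)` with `0 < |F(x, y)| ≤ m` and `0 ≤ y ≤ Y`. -/
def primitiveSolutions (F : BinForm) (m Y : ℝ) : Set (ℤ × ℤ) :=
  {p | Int.gcd p.1 p.2 = 1 ∧ F.value p.1 p.2 ≠ 0 ∧ |(F.value p.1 p.2 : ℝ)| ≤ m ∧
    0 ≤ p.2 ∧ (p.2 : ℝ) ≤ Y}

theorem smallSolutions_subset {n m : ℕ} (hm : 1 ≤ m) (F : BinForm) :
    smallSolutions n m F ⊆ F.primitiveSolutions m ((F.mahler / m) ^ 5) := by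
  rintro p ⟨hgcd, hlow, hup, hy⟩
  have hmR : (0 : ℝ) < m := by exact_mod_cast hm
  have hv : (0 : ℝ) < F.value p.1 p.2 := (div_pos hmR (by positivity)).trans_le hlow
  exact ⟨hgcd, by exact_mod_cast hv.ne', (abs_of_pos hv).trans_le hup.le, hy⟩

theorem encard_primitiveSolutions_snd_pos_le {F : BinForm} {m Y Q : ℝ} {k : ℕ}
    (hF : F.IsHomogeneous F.dehom.natDegree) (hmin : F.HasMinimalMahler) (hQ : 1 < Q)
    (hYQ : Y ≤ Q ^ k) (hQM : m * 3 ^ F.dehom.natDegree * Q ≤ F.mahler) :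
    {p ∈ F.primitiveSolutions m Y | 0 < p.2}.encard ≤ ((k + 1) * F.dehom.natDegree : ℕ) := by
  rw [← card_root_index]
  refine encard_le_of_gap (y := fun p => (p.2 : ℝ)) (v := fun i => closeness (F.root i)) hQ
    ?_ ?_ ?_ ?_ ?_
  · exact fun p hp => by exact_mod_cast hp.2
  · exact fun p hp => hp.1.2.2.2.2.trans hYQ
  · exact fun i p _ => one_le_closeness _ p
  · exact fun i p hp q hq hne hle =>
      closeness_le_div hp.2 (by exact_mod_cast hle) hp.1.1 hq.1.1 hne
  · rintro p ⟨⟨hgcd, hv, hvm, -⟩, hy⟩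
    have hm : 0 < m := (abs_pos.mpr (Int.cast_ne_zero.mpr hv)).trans_le hvm
    have hc : 0 ≤ ∏ i, closeness (F.root i) p :=
      Finset.prod_nonneg fun i _ => zero_le_one.trans (one_le_closeness _ p)
    refine le_of_mul_le_mul_left ?_ (by positivity : 0 < m * 3 ^ F.dehom.natDegree)
    calc m * 3 ^ F.dehom.natDegree * Q ≤ F.mahler := hQM
      _ ≤ |(F.value p.1 p.2 : ℝ)| * (3 ^ F.dehom.natDegree * ∏ i, closeness (F.root i) p) :=
        mahler_le_abs_value_mul_prod_closeness hF hmin hy hgcd hv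
      _ ≤ m * (3 ^ F.dehom.natDegree * ∏ i, closeness (F.root i) p) := by gcongr
      _ = m * 3 ^ F.dehom.natDegree * ∏ i, closeness (F.root i) p := (mul_assoc _ _ _).symm

theorem encard_primitiveSolutions_le (F : BinForm) (m Y : ℝ) :
    (F.primitiveSolutions m Y).encard ≤ {p ∈ F.primitiveSolutions m Y | 0 < p.2}.encard + 2 := by
  have hcover : F.primitiveSolutions m Y ⊆ {p ∈ F.primitiveSolutions m Y | 0 < p.2} ∪
      {p | Int.gcd p.1 p.2 = 1 ∧ p.2 = 0} := fun p hp =>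
    hp.2.2.2.1.lt_or_eq.imp (⟨hp, ·⟩) (⟨hp.1, ·.symm⟩)
  calc (F.primitiveSolutions m Y).encard
      ≤ _ := Set.encard_le_encard hcover
    _ ≤ _ := Set.encard_union_le _ _
    _ ≤ _ := by
      gcongr
      exact encard_primitive_snd_eq_zero_le

end Solutions

end BinForm

theorem eighteen_pow_le_exp (n : ℕ) : (18 : ℝ) ^ n ≤ Real.exp (200 * n) := by
  rw [mul_comm, Real.exp_nat_mul]
  gcongr
  linarith [Real.add_one_le_exp (200 : ℝ)]

theorem proposition5p1_general {n k : ℕ} {m : ℝ} {F : BinForm} (hn : 2 ≤ n)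
    (hF : F.IsHomogeneous n) (hlead : F.coeff (Finsupp.single 0 n) ≠ 0)
    (hmin : F.HasMinimalMahler) (hm : 0 < m)
    (hmD : m ≤ ‖F.discr‖ ^ (1 / (2 * ((n : ℝ) - 1))) / 18 ^ n) :
    (F.primitiveSolutions m ((F.mahler / m) ^ k)).encard ≤ (2 * (k + 1) * n : ℕ) := by
  have hdeg : F.dehom.natDegree = n := BinForm.natDegree_dehom hF hlead
  set K := F.mahler / m
  have hmK : m * K = F.mahler := mul_div_cancel₀ _ hm.ne'
  have hKn : 9 ^ n ≤ K := (le_div_iff₀ hm).mpr <|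
    BinForm.pow_mul_le_mahler hn hdeg (by norm_num) (hmD.trans_eq (by norm_num))
  have hK0 : 0 < K := (by positivity : (0 : ℝ) < 9 ^ n).trans_le hKn
  have h39 : (3 : ℝ) ^ n * 3 ^ n = 9 ^ n := by rw [← mul_pow]; norm_num
  have hQ : 3 ^ n ≤ K / 3 ^ n := by rwa [le_div_iff₀ (by positivity), h39]
  have hKQ : K ≤ (K / 3 ^ n) ^ 2 := by
    rw [div_pow, pow_two (3 ^ n), h39, le_div_iff₀ (by positivity), pow_two]
    gcongr
  have hpos : {p ∈ F.primitiveSolutions m (K ^ k) | 0 < p.2}.encard ≤ ((2 * k + 1) * n : ℕ) := by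
    rw [← hdeg]
    refine BinForm.encard_primitiveSolutions_snd_pos_le (Q := K / 3 ^ n) (by rwa [hdeg]) hmin
      ((one_lt_pow₀ (by norm_num) (by omega)).trans_le hQ) ?_ ?_
    · rw [pow_mul]
      gcongr
    · rw [hdeg, mul_assoc, mul_div_cancel₀ _ (by positivity), hmK]
  calc (F.primitiveSolutions m (K ^ k)).encard
      ≤ {p ∈ F.primitiveSolutions m (K ^ k) | 0 < p.2}.encard + 2 :=
        F.encard_primitiveSolutions_le m (K ^ k)
    _ ≤ ((2 * k + 1) * n : ℕ) + 2 := by gcongr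
    _ ≤ (2 * (k + 1) * n : ℕ) := by
        norm_cast
        linarith

theorem proposition5p1 :
    ∃ c : ℝ, 0 < c ∧
      ∀ (n s m : ℕ) (F : BinForm), 3 ≤ n → 1 ≤ s → 1 ≤ m →
        F ∈ BinForm.classC n (4 * s - 2) →
        F.HasMinimalMahler →
        ((n * (n - 1) : ℕ) : ℝ) ^ (8 * n * (n - 1)) < ‖F.discr‖ →
        (m : ℝ) ≤ ‖F.discr‖ ^ (1 / (2 * ((n : ℝ) - 1))) / Real.exp (200 * n) →
        (BinForm.smallSolutions n m F).Finite ∧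
          ((BinForm.smallSolutions n m F).ncard : ℝ) ≤ c * n := by
  refine ⟨12, by norm_num, fun n s m F hn _ hm hF hmin _ hmD => ?_⟩
  have hlead := BinForm.coeff_ne_zero_of_irreducible (by omega) (hF.1.map _) hF.2.1
  rw [MvPolynomial.coeff_map] at hlead
  have hcard : (BinForm.smallSolutions n m F).encard ≤ (2 * (5 + 1) * n : ℕ) :=
    (Set.encard_le_encard (BinForm.smallSolutions_subset hm F)).trans <|
      proposition5p1_general (by omega) hF.1 (ne_zero_of_map hlead) hmin (by positivity) <|
        hmD.trans <| by gcongr; exact eighteen_pow_le_exp n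
  exact_mod_cast Set.encard_le_coe_iff_finite_ncard_le.mp hcard
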